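/- Let $\mathbf{k}$ be a commutative unital ring, $X$ a set and $\Omega$ a semigroup. *Trees.* Let $\mathcal T$ be the set of planar rooted trees with at least one vertex, in which the leaves and the root are drawn as edges, each angle between consecutive incoming edges of a vertex is decorated by an element of $X$, each internal edge has a type in $\Omega$, and each leaf edge has type $1\in\Omega^1$. Write $|$ for the tree without vertices. An element of $\mathcal T$ is written $T=(b_1\,x_1\,b_2\cdots x_m\,b_{m+1})$, $m\ge 0$, where $b_1,\dots,b_{m+1}$ are the incoming edges of its root vertex from left to right (each $b_i$ is a leaf, or an internal edge of some type $\alpha_i\in\Omega$ carrying a tree $T_i\in\mathcal T$) and $x_i\in X$ decorates the angle between $b_i$ and $b_{i+1}$. For $\omega\in\Omega$ let $B^+_\omega(T)$ be the tree whose root vertex has a single incoming edge, of type $\omega$ and carrying $T$; extend $B^+_\omega$ linearly to $\mathbf k\mathcal T$. The product $\diamond$ of weight $\lambda\in\mathbf k$ on $\mathbf k\mathcal T$ is bilinear and defined recursively, for $T$ as above and $U=(c_1\,y_1\cdots y_n\,c_{n+1})$, by $$T\diamond U=(b_1\,x_1\cdots x_m\;d\;y_1\,c_2\cdots y_n\,c_{n+1}),$$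 where $d=c_1$ if $b_{m+1}$ is a leaf, $d=b_{m+1}$ if $c_1$ is a leaf, and, if $b_{m+1}$ has type $\alpha$ and carries $S$ while $c_1$ has type $\beta$ and carries $V$, $d$ is the edge of type $\alpha\beta$ carrying $B^+_\alpha(S)\diamond V+S\diamond B^+_\beta(V)+\lambda\,S\diamond V$ (expanded linearly). *Binary trees.* Let $Y\subset\mathcal T$ be the set of trees all of whose vertices have exactly two incoming edges, and let $\mathbf kY$ be the free module on it. For $T^l,T^r\in Y\sqcup\{|\}$ write $T=T^l\vee_{x,(\alpha_1,\alpha_2)}T^r$ for the binary tree with root angle $x$ and root edges of types $\alpha_1,\alpha_2\in\Omega^1$ carrying $T^l,T^r$ (the type being $1$ exactly for a leaf edge). Bilinear operations $\prec_\omega,\succ_\omega$ on $\mathbf kY$ are defined recursively by $$T\prec_\omega U=T^l\vee_{x,(\alpha_1,\alpha_2\omega)}(T^r\prec_\omega U+T^r\succ_{\alpha_2}U),\qquad T\succ_\omega U=(T\prec_{\beta_1}U^l+T\succ_\omega U^l)\vee_{y,(\omega\beta_1,\beta_2)}U^r$$ for $T=T^l\vee_{x,(\alpha_1,\alpha_2)}T^r$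 and $U=U^l\vee_{y,(\beta_1,\beta_2)}U^r$, with the conventions $|\succ_\omega T=T\prec_\omega|=T$ and $|\prec_\omega T=T\succ_\omega|=0$ for $\omega\in\Omega^1$, $T\in Y$. *Algebras.* A Rota–Baxter family algebra of weight $\lambda$ is a unital associative $\mathbf k$-algebra $R$ with linear operators $(P_\omega)_{\omega\in\Omega}$ such that $P_\alpha(a)P_\beta(b)=P_{\alpha\beta}(P_\alpha(a)b+aP_\beta(b)+\lambda ab)$. A dendriform family algebra is a $\mathbf k$-module with bilinear operations $(\prec_\omega,\succ_\omega)_{\omega\in\Omega}$ such that $$(x\prec_\alpha y)\prec_\beta z=x\prec_{\alpha\beta}(y\prec_\beta z+y\succ_\alpha z),\quad (x\succ_\alpha y)\prec_\beta z=x\succ_\alpha(y\prec_\beta z),\quad (x\prec_\beta y+x\succ_\alpha y)\succ_{\alpha\beta}z=x\succ_\alpha(y\succ_\beta z).$$ **Theorem 3.4.** Take $\lambda=0$. Then $(\mathbf k\mathcal T,\diamond,(B^+_\omega)_{\omega\in\Omega})$, with the one-vertex one-leaf tree as unit and with the map sending $x\in X$ to the one-vertex two-leaf tree with angle $x$, is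 the free Rota–Baxter family algebra of weight $0$ on $X$; and $(\mathbf kY,(\prec_\omega,\succ_\omega)_{\omega\in\Omega})$, with the same map, is the free dendriform family algebra on $X$. Moreover $\mathbf k\mathcal T$ is a dendriform family algebra for the operations $a\prec'_\omega b=a\diamond B^+_\omega(b)$ and $a\succ'_\omega b=B^+_\omega(a)\diamond b$, and the free dendriform family algebra $\mathbf kY$ is a dendriform family subalgebra of it: the natural inclusion $\iota:\mathbf kY\to\mathbf k\mathcal T$ is injective, its image is the span of the binary trees, this span is closed under all $\prec'_\omega$ and $\succ'_\omega$, $\iota$ respects the generators $x\in X$, and for all $\omega\in\Omega$ and $a,b\in\mathbf kY$ $$\iota(a\prec_\omega b)=\iota(a)\diamond B^+_\omega(\iota(b)),\qquad \iota(a\succ_\omega b)=B^+_\omega(\iota(a))\diamond\iota(b).$$ -/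

import Mathlib

universe w

namespace FamilyTrees

/-- An incoming edge of a vertex, with what sits on top of it: either a leaf (the zero-vertex
tree `|`), or an internal edge of type `ω` that carries a tree `t`. A leaf carries no datum;
this is the convention that leaf edges have type `1 ∈ Ω¹` and internal edges a type in `Ω`. -/
inductive Branch (Ω : Type*) (T : Type*) where
  | leaf : Branch Ω T
  | edge (ω : Ω) (t : T) : Branch Ω T

/-- `X`-angularly decorated `Ω`-typed planar rooted trees (with at least one vertex). A tree is
given by the incoming edges of its root vertex, listed from left to right with the decorations of
the angles between consecutive ones: `b₁ x₁ b₂ x₂ … xₙ bₙ₊₁`, `n ≥ 0`. Here `last b` is the vertex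
with the single incoming edge `b`, and `cons b x T` puts a further incoming edge `b` to the left of
those of the root vertex of `T`, the new angle being decorated by `x`. -/
inductive PTree (X : Type*) (Ω : Type*) where
  | last (b : Branch Ω (PTree X Ω)) : PTree X Ω
  | cons (b : Branch Ω (PTree X Ω)) (x : X) (T : PTree X Ω) : PTree X Ω

/-- `X`-decorated `Ω`-typed planar binary trees with at least one vertex: the root vertex has a left
and a right incoming edge and one angle, decorated by `x`. -/
inductive BTree (X : Type*) (Ω : Type*) where
  | node (l : Branch Ω (BTree X Ω)) (x : X) (r : Branch Ω (BTree X Ω)) : BTree X Ω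

section Trees

variable {X Ω : Type*}

namespace PTree

/-- The leftmost incoming edge of the root vertex. -/
def firstBranch : PTree X Ω → Branch Ω (PTree X Ω)
  | last b => b
  | cons b _ _ => b

/-- The rightmost incoming edge of the root vertex. -/
def lastBranch : PTree X Ω → Branch Ω (PTree X Ω)
  | last b => b
  | cons _ _ T => T.lastBranch

/-- Replace the leftmost incoming edge of the root vertex by `b`. -/
def setFirst (b : Branch Ω (PTree X Ω)) : PTree X Ω → PTree X Ω
  | last _ => last b
  | cons _ x T => cons b x T

/-- For `T = b₁ x₁ … bₘ xₘ bₘ₊₁` and `U = c₁ y₁ c₂ … yₙ cₙ₊₁`, the tree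
`T.glue b U = b₁ x₁ … bₘ xₘ b y₁ c₂ … yₙ cₙ₊₁`, in which `b` takes the place both of the rightmost
edge of `T` and of the leftmost edge of `U`. -/
def glue : PTree X Ω → Branch Ω (PTree X Ω) → PTree X Ω → PTree X Ω
  | last _, b, U => U.setFirst b
  | cons c x T, b, U => cons c x (T.glue b U)

/-- The tree `B⁺_ω(T)`: a new root vertex whose only incoming edge has type `ω` and carries `T`. -/
def graft (ω : Ω) (T : PTree X Ω) : PTree X Ω := last (.edge ω T)

theorem size_first_lt {U V : PTree X Ω} {β : Ω} (h : U.firstBranch = .edge β V) :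
    sizeOf V < sizeOf (graft β V) ∧ sizeOf (graft β V) ≤ sizeOf U := by
  cases U <;> simp only [firstBranch] at h <;> subst h <;> simp [graft] <;> omega

theorem size_last_lt {T S : PTree X Ω} {α : Ω} (h : T.lastBranch = .edge α S) :
    sizeOf S < sizeOf (graft α S) ∧ sizeOf (graft α S) ≤ sizeOf T := by
  match T with
  | last b =>
    simp only [lastBranch] at h
    subst h
    simp [graft]
    omega
  | cons b x T =>
    simp only [lastBranch] at h
    have := size_last_lt h
    simp only [cons.sizeOf_spec]
    omega

mutual
/-- A tree is binary if each of its vertices has exactly two incoming edges. -/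
def IsBinary : PTree X Ω → Prop
  | cons b _ (last c) => BranchIsBinary b ∧ BranchIsBinary c
  | _ => False
/-- The tree that sits on top of an edge, if any, is binary. -/
def BranchIsBinary : Branch Ω (PTree X Ω) → Prop
  | .leaf => True
  | .edge _ T => IsBinary T
end

end PTree

mutual
/-- The natural inclusion of binary trees into planar rooted trees. -/
def BTree.toPTree : BTree X Ω → PTree X Ω
  | .node l x r => .cons (branchToPTree l) x (.last (branchToPTree r))
/-- The natural inclusion, on the incoming edges. -/
def branchToPTree : Branch Ω (BTree X Ω) → Branch Ω (PTree X Ω)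
  | .leaf => .leaf
  | .edge ω T => .edge ω T.toPTree
end

end Trees

noncomputable section Operations

variable (k : Type*) [CommRing k] {X Ω : Type*}

/-- The `k`-bilinear extension of a map given on pairs of basis elements. -/
def bilinExt {S T M : Type*} [AddCommGroup M] [Module k M] (f : S → T → M) :
    (S →₀ k) →ₗ[k] (T →₀ k) →ₗ[k] M :=
  Finsupp.linearCombination k fun s => Finsupp.linearCombination k (f s)

variable {k} in
/-- The product `T ⋄ U` of weight `lam` of two trees. If the rightmost edge of `T` or the leftmost
edge of `U` is a leaf, then `T` and `U` are joined at their roots, the two extreme edges being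
identified. If these edges are internal, of types `α` and `β`, with trees `S` and `V` on top,
they are replaced by one edge of type `αβ`, which carries
`B⁺_α(S) ⋄ V + S ⋄ B⁺_β(V) + lam (S ⋄ V)`. -/
def diamondTree [Semigroup Ω] (lam : k) (T U : PTree X Ω) : PTree X Ω →₀ k :=
  match _hT : T.lastBranch, _hU : U.firstBranch with
  | .leaf, c => Finsupp.single (T.glue c U) 1
  | .edge α S, .leaf => Finsupp.single (T.glue (.edge α S) U) 1
  | .edge α S, .edge β V =>
      (diamondTree lam (PTree.graft α S) V + diamondTree lam S (PTree.graft β V)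
        + lam • diamondTree lam S V).mapDomain fun W => T.glue (.edge (α * β) W) U
termination_by sizeOf T + sizeOf U
decreasing_by
  all_goals
    have h1 := PTree.size_last_lt _hT
    have h2 := PTree.size_first_lt _hU
    omega

/-- The bilinear product `⋄` of weight `lam` on `k𝒯`. -/
def diamond [Semigroup Ω] (lam : k) :
    (PTree X Ω →₀ k) →ₗ[k] (PTree X Ω →₀ k) →ₗ[k] (PTree X Ω →₀ k) :=
  bilinExt k (diamondTree lam)

/-- The linear operator `B⁺_ω` on `k𝒯`. -/
def Bplus (ω : Ω) : (PTree X Ω →₀ k) →ₗ[k] (PTree X Ω →₀ k) :=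
  Finsupp.lmapDomain k k (PTree.graft ω)

/-- The tree with one vertex and one leaf. -/
def unitTree : PTree X Ω →₀ k := Finsupp.single (.last .leaf) 1

/-- The tree with one vertex and two leaves, whose angle is decorated by `x`, as an element
of `k𝒯`. -/
def genTree (x : X) : PTree X Ω →₀ k := Finsupp.single (.cons .leaf x (.last .leaf)) 1

/-- The tree with one vertex and two leaves, whose angle is decorated by `x`, as an element of the
span of the binary trees. -/
def genBTree (x : X) : BTree X Ω →₀ k := Finsupp.single (.node .leaf x .leaf) 1

/- The recursive operations on binary trees. For `T = Tˡ ∨_{x,(α₁,α₂)} Tʳ` and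
`U = Uˡ ∨_{y,(β₁,β₂)} Uʳ`,
`T ≺_ω U = Tˡ ∨_{x,(α₁,α₂ω)} (Tʳ ≺_ω U + Tʳ ≻_{α₂} U)` and
`T ≻_ω U = (T ≺_{β₁} Uˡ + T ≻_ω Uˡ) ∨_{y,(ωβ₁,β₂)} Uʳ`.
If `Tʳ = |`, then `α₂ = 1`, `| ≺_ω U = 0` and `| ≻_1 U = U`, so that
`T ≺_ω U = Tˡ ∨_{x,(α₁,ω)} U`; if `Uˡ = |`, then `β₁ = 1`, `T ≺_1 | = T` and `T ≻_ω | = 0`, so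
that `T ≻_ω U = T ∨_{y,(ω,β₂)} Uʳ`. -/
mutual
/-- The operation `≺_ω` on binary trees. -/
def precTree [Semigroup Ω] (ω : Ω) : BTree X Ω → BTree X Ω → (BTree X Ω →₀ k)
  | .node l x .leaf, U => Finsupp.single (.node l x (.edge ω U)) 1
  | .node l x (.edge α R), U =>
      (precTree ω R U + succTree α R U).mapDomain fun W => .node l x (.edge (α * ω) W)
termination_by T U => sizeOf T + sizeOf U
/-- The operation `≻_ω` on binary trees. -/
def succTree [Semigroup Ω] (ω : Ω) : BTree X Ω → BTree X Ω → (BTree X Ω →₀ k)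
  | T, .node .leaf y r => Finsupp.single (.node (.edge ω T) y r) 1
  | T, .node (.edge β L) y r =>
      (precTree β T L + succTree ω T L).mapDomain fun W => .node (.edge (ω * β) W) y r
termination_by T U => sizeOf T + sizeOf U
end

/-- The bilinear operation `≺_ω` on the span of the binary trees. -/
def prec [Semigroup Ω] (ω : Ω) :
    (BTree X Ω →₀ k) →ₗ[k] (BTree X Ω →₀ k) →ₗ[k] (BTree X Ω →₀ k) :=
  bilinExt k (precTree k ω)

/-- The bilinear operation `≻_ω` on the span of the binary trees. -/
def succ [Semigroup Ω] (ω : Ω) :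
    (BTree X Ω →₀ k) →ₗ[k] (BTree X Ω →₀ k) →ₗ[k] (BTree X Ω →₀ k) :=
  bilinExt k (succTree k ω)

/-- The linear extension of the natural inclusion of binary trees. -/
def incl : (BTree X Ω →₀ k) →ₗ[k] (PTree X Ω →₀ k) :=
  Finsupp.lmapDomain k k BTree.toPTree

variable (X Ω) in
/-- The submodule of `k𝒯` spanned by the binary trees. -/
def binarySpan : Submodule k (PTree X Ω →₀ k) :=
  Submodule.span k ((fun T => Finsupp.single T 1) '' {T : PTree X Ω | T.IsBinary})

/-- The operation `a ≺'_ω b = a ⋆ P_ω(b)` induced by a product and a family of operators. -/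
def inducedPrec {R : Type*} [AddCommGroup R] [Module k R]
    (mul : R →ₗ[k] R →ₗ[k] R) (P : Ω → R →ₗ[k] R) (ω : Ω) : R →ₗ[k] R →ₗ[k] R :=
  mul.compl₂ (P ω)

/-- The operation `a ≻'_ω b = P_ω(a) ⋆ b` induced by a product and a family of operators. -/
def inducedSucc {R : Type*} [AddCommGroup R] [Module k R]
    (mul : R →ₗ[k] R →ₗ[k] R) (P : Ω → R →ₗ[k] R) (ω : Ω) : R →ₗ[k] R →ₗ[k] R :=
  mul ∘ₗ P ω

end Operations

section Algebras

variable {k : Type*} [CommRing k] {X Ω : Type*} [Semigroup Ω]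

/-- `R`, with the bilinear product `mul`, the unit `one` and the operators `P`, is a (unital,
associative) Rota–Baxter family algebra of weight `lam`. -/
structure IsRotaBaxterFamilyAlgebra {R : Type*} [AddCommGroup R] [Module k R] (lam : k)
    (mul : R →ₗ[k] R →ₗ[k] R) (one : R) (P : Ω → R →ₗ[k] R) : Prop where
  assoc : ∀ a b c, mul (mul a b) c = mul a (mul b c)
  one_mul : ∀ a, mul one a = a
  mul_one : ∀ a, mul a one = a
  rota_baxter : ∀ α β a b,
    mul (P α a) (P β b) = P (α * β) (mul (P α a) b + mul a (P β b) + lam • mul a b)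

/-- `R`, with the map `j`, is a free Rota–Baxter family algebra of weight `lam` on `X`. -/
def IsFreeRotaBaxterFamilyAlgebra {R : Type*} [AddCommGroup R] [Module k R] (lam : k)
    (mul : R →ₗ[k] R →ₗ[k] R) (one : R) (P : Ω → R →ₗ[k] R) (j : X → R) : Prop :=
  IsRotaBaxterFamilyAlgebra lam mul one P ∧
  ∀ (A : Type w) [AddCommGroup A] [Module k A] (mul' : A →ₗ[k] A →ₗ[k] A) (one' : A)
    (P' : Ω → A →ₗ[k] A), IsRotaBaxterFamilyAlgebra lam mul' one' P' →
    ∀ f : X → A, ∃! F : R →ₗ[k] A,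
      F one = one' ∧ (∀ a b, F (mul a b) = mul' (F a) (F b)) ∧
      (∀ ω a, F (P ω a) = P' ω (F a)) ∧ ∀ x, F (j x) = f x

/-- `D`, with the bilinear operations `≺_ω = prec ω` and `≻_ω = succ ω`, is a dendriform family
algebra. -/
structure IsDendriformFamilyAlgebra {D : Type*} [AddCommGroup D] [Module k D]
    (prec succ : Ω → D →ₗ[k] D →ₗ[k] D) : Prop where
  prec_prec : ∀ α β x y z,
    prec β (prec α x y) z = prec (α * β) x (prec β y z + succ α y z)
  succ_prec : ∀ α β x y z,
    prec β (succ α x y) z = succ α x (prec β y z)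
  succ_succ : ∀ α β x y z,
    succ (α * β) (prec β x y + succ α x y) z = succ α x (succ β y z)

/-- A linear map compatible with the dendriform family operations. -/
structure IsDendriformFamilyHom {D E : Type*} [AddCommGroup D] [Module k D] [AddCommGroup E]
    [Module k E] (prec succ : Ω → D →ₗ[k] D →ₗ[k] D) (prec' succ' : Ω → E →ₗ[k] E →ₗ[k] E)
    (F : D →ₗ[k] E) : Prop where
  map_prec : ∀ ω a b, F (prec ω a b) = prec' ω (F a) (F b)
  map_succ : ∀ ω a b, F (succ ω a b) = succ' ω (F a) (F b)

/-- `D`, with the map `j`, is a free dendriform family algebra on `X`. -/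
def IsFreeDendriformFamilyAlgebra {D : Type*} [AddCommGroup D] [Module k D]
    (prec succ : Ω → D →ₗ[k] D →ₗ[k] D) (j : X → D) : Prop :=
  IsDendriformFamilyAlgebra prec succ ∧
  ∀ (E : Type w) [AddCommGroup E] [Module k E] (prec' succ' : Ω → E →ₗ[k] E →ₗ[k] E),
    IsDendriformFamilyAlgebra prec' succ' →
    ∀ f : X → E, ∃! F : D →ₗ[k] E,
      IsDendriformFamilyHom prec succ prec' succ' F ∧ ∀ x, F (j x) = f x

/-- A submodule of a dendriform family algebra that is stable under all the operations. -/
structure IsDendriformFamilySubalgebra {E : Type*} [AddCommGroup E] [Module k E]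
    (prec succ : Ω → E →ₗ[k] E →ₗ[k] E) (S : Submodule k E) : Prop where
  isDendriform : IsDendriformFamilyAlgebra prec succ
  prec_mem : ∀ ω, ∀ a ∈ S, ∀ b ∈ S, prec ω a b ∈ S
  succ_mem : ∀ ω, ∀ a ∈ S, ∀ b ∈ S, succ ω a b ∈ S

end Algebras

end FamilyTrees

-- A product `T ⋄ U` alters only the rightmost root edge of `T` and the leftmost root edge of `U`.
-- Hence a factor can be cut at a root angle and the part away from the junction pulled out
-- (`diamond_joinₗ_left`, `diamond_joinₗ_right`). Every tree arises from the unit by grafting and by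
-- joining at an angle, so statements about products reduce to factors whose root has one internal
-- edge; there the definition of `⋄` is the Rota–Baxter identity (`Bplus_diamond_Bplus`). Induction
-- on total size then gives associativity and the multiplicativity of evaluation of trees. As a tree
-- `b x T` is the product of `b`, the generator `x` and `T` (`single_cons_eq_diamond`), evaluation
-- is the only possible morphism. All this works for every weight.
--
-- For weight 0, `a ⋄ B⁺_ω(b)` and `B⁺_ω(a) ⋄ b` satisfy the dendriform axioms. A binary tree with
-- both root edges internal is `(L ≻ x) ≺ R`, and under this reading the recursive formulas for
-- `≺_ω` and `≻_ω` are the first and third axioms. So a linear map into a dendriform family algebra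
-- that respects such decompositions is a morphism (`isDendriformFamilyHom_of_node`). Applied to the
-- inclusion into `k𝒯`, which is injective, this transfers the axioms to binary trees; applied to
-- evaluation of binary trees, it gives freeness.

namespace FamilyTrees

noncomputable section

-- Bilinear maps on free modules.

section Basis

variable {k : Type*} [CommRing k] {S T M : Type*} [AddCommGroup M] [Module k M]

theorem induction_basis {p : (S →₀ k) → Prop} (zero : p 0)
    (add : ∀ a b, p a → p b → p (a + b)) (smul : ∀ (r : k) a, p a → p (r • a))
    (single : ∀ s, p (Finsupp.single s 1)) (a : S →₀ k) : p a := by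
  induction a using Finsupp.induction_linear with
  | zero => exact zero
  | add a b ha hb => exact add a b ha hb
  | single s r => simpa using smul r _ (single s)

@[simp]
theorem bilinExt_single (f : S → T → M) (s : S) (t : T) :
    bilinExt k f (Finsupp.single s 1) (Finsupp.single t 1) = f s t := by
  simp [bilinExt]

theorem bilinear_ext {f g : (S →₀ k) →ₗ[k] (T →₀ k) →ₗ[k] M}
    (h : ∀ s t, f (Finsupp.single s 1) (Finsupp.single t 1) =
      g (Finsupp.single s 1) (Finsupp.single t 1)) : f = g := by
  ext s t
  simpa using h s t

end Basis

-- Combinatorics of planar and binary trees.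

section Trees

variable {X Ω : Type*}

namespace PTree

/-- The type is nested through `Branch`, so its recursor needs a second motive for edges.
Representing an edge `b` by the one-edge tree `last b` makes a single motive suffice. -/
theorem induction_on {p : PTree X Ω → Prop} (T : PTree X Ω) (leaf : p (last .leaf))
    (graft : ∀ ω T, p T → p (graft ω T))
    (cons : ∀ b x T, p (last b) → p T → p (cons b x T)) : p T :=
  match T with
  | .last .leaf => leaf
  | .last (.edge ω T) => graft ω T (induction_on T leaf graft cons)
  | .cons .leaf x T => cons _ x T leaf (induction_on T leaf graft cons)
  | .cons (.edge ω S) x T =>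
      cons _ x T (graft ω S (induction_on S leaf graft cons)) (induction_on T leaf graft cons)

@[simp]
theorem sizeOf_pos (T : PTree X Ω) : 0 < sizeOf T := by
  cases T <;> simp

/-- `T.join x U` is the tree whose root vertex has the incoming edges of that of `T` followed by
those of that of `U`, with a new angle decorated by `x` in between. -/
def join (x : X) : PTree X Ω → PTree X Ω → PTree X Ω
  | last b, U => cons b x U
  | cons b y T, U => cons b y (T.join x U)

@[simp]
theorem lastBranch_join (x : X) (T U : PTree X Ω) :
    (T.join x U).lastBranch = U.lastBranch := by
  induction T using induction_on with
  | leaf => rfl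
  | graft => rfl
  | cons b y T _ ih => exact ih

@[simp]
theorem firstBranch_join (x : X) (T U : PTree X Ω) :
    (T.join x U).firstBranch = T.firstBranch := by
  cases T <;> rfl

/-- Gluing reaches only the rightmost edge of its left argument, which lies in `U`. -/
theorem join_glue (x : X) (T U W : PTree X Ω) (d : Branch Ω (PTree X Ω)) :
    (T.join x U).glue d W = T.join x (U.glue d W) := by
  induction T using induction_on with
  | leaf => rfl
  | graft => rfl
  | cons b y T _ ih => simp [join, glue, ih]

theorem glue_join (x : X) (T U W : PTree X Ω) (d : Branch Ω (PTree X Ω)) :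
    T.glue d (U.join x W) = (T.glue d U).join x W := by
  induction T using induction_on with
  | leaf => cases U <;> rfl
  | graft => cases U <;> rfl
  | cons b y T _ ih => simp [join, glue, ih]

theorem glue_lastBranch (T : PTree X Ω) (b : Branch Ω (PTree X Ω)) :
    T.glue T.lastBranch (last b) = T := by
  induction T using induction_on with
  | leaf => rfl
  | graft => rfl
  | cons c y T _ ih => simp [lastBranch, glue, ih]

theorem setFirst_firstBranch (T : PTree X Ω) : T.setFirst T.firstBranch = T := by
  cases T <;> rfl

end PTree

namespace BTree

/-- The hypotheses are conditional on an edge being internal, so that leaves and internal edges need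
no separate cases. -/
theorem induction_on {p : BTree X Ω → Prop} (T : BTree X Ω)
    (node : ∀ l x r, (∀ ω L, l = .edge ω L → p L) → (∀ ω R, r = .edge ω R → p R) →
      p (.node l x r)) : p T :=
  match T with
  | .node .leaf x .leaf => node _ _ _ (by simp) (by simp)
  | .node .leaf x (.edge β R) =>
      node _ _ _ (by simp) (fun _ _ h => by cases h; exact induction_on R node)
  | .node (.edge α L) x .leaf =>
      node _ _ _ (fun _ _ h => by cases h; exact induction_on L node) (by simp)
  | .node (.edge α L) x (.edge β R) =>
      node _ _ _ (fun _ _ h => by cases h; exact induction_on L node)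
        (fun _ _ h => by cases h; exact induction_on R node)

theorem toPTree_injective : Function.Injective (toPTree : BTree X Ω → PTree X Ω) := by
  intro T
  induction T using induction_on with
  | node l x r hl hr =>
    rintro ⟨l', y, r'⟩ h
    simp only [toPTree, PTree.cons.injEq, PTree.last.injEq] at h
    obtain ⟨h₁, rfl, h₂⟩ := h
    have key : ∀ b : Branch Ω (BTree X Ω),
        (∀ ω L, b = .edge ω L → ∀ ⦃U : BTree X Ω⦄, L.toPTree = U.toPTree → L = U) →
        ∀ c, branchToPTree b = branchToPTree c → b = c := by
      rintro (_ | ⟨ω, L⟩) hb (_ | ⟨ω', L'⟩) h <;>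
        simp only [branchToPTree, Branch.edge.injEq, reduceCtorEq] at h ⊢
      exact ⟨h.1, hb _ _ rfl h.2⟩
    rw [key l hl _ h₁, key r hr _ h₂]

theorem isBinary_toPTree (T : BTree X Ω) : T.toPTree.IsBinary := by
  induction T using induction_on with
  | node l x r hl hr =>
    have key : ∀ b : Branch Ω (BTree X Ω),
        (∀ ω L, b = .edge ω L → L.toPTree.IsBinary) → PTree.BranchIsBinary (branchToPTree b) := by
      rintro (_ | ⟨ω, L⟩) hb
      · simp [branchToPTree, PTree.BranchIsBinary]
      · simpa [branchToPTree, PTree.BranchIsBinary] using hb _ _ rfl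
    simpa [toPTree, PTree.IsBinary] using ⟨key l hl, key r hr⟩

end BTree

mutual
theorem PTree.IsBinary.exists_toPTree :
    ∀ {T : PTree X Ω}, T.IsBinary → ∃ S : BTree X Ω, S.toPTree = T
  | .cons b x (.last c), h => by
    simp only [PTree.IsBinary] at h
    obtain ⟨l, rfl⟩ := PTree.BranchIsBinary.exists_branchToPTree h.1
    obtain ⟨r, rfl⟩ := PTree.BranchIsBinary.exists_branchToPTree h.2
    exact ⟨.node l x r, by simp [BTree.toPTree]⟩
  | .last _, h => by simp [PTree.IsBinary] at h
  | .cons _ _ (.cons _ _ _), h => by simp [PTree.IsBinary] at h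
theorem PTree.BranchIsBinary.exists_branchToPTree :
    ∀ {b : Branch Ω (PTree X Ω)}, PTree.BranchIsBinary b →
      ∃ c : Branch Ω (BTree X Ω), branchToPTree c = b
  | .leaf, _ => ⟨.leaf, by simp [branchToPTree]⟩
  | .edge ω T, h => by
    simp only [PTree.BranchIsBinary] at h
    obtain ⟨S, rfl⟩ := PTree.IsBinary.exists_toPTree h
    exact ⟨.edge ω S, by simp [branchToPTree]⟩
end

end Trees

-- The product on planar trees: Rota–Baxter identity and associativity.

section Diamond

variable {k : Type*} [CommRing k] {X Ω : Type*}

/-- The bilinear extension of `PTree.join x`. -/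
def joinₗ (x : X) : (PTree X Ω →₀ k) →ₗ[k] (PTree X Ω →₀ k) →ₗ[k] (PTree X Ω →₀ k) :=
  bilinExt k fun T U => Finsupp.single (T.join x U) 1

@[simp]
theorem joinₗ_single (x : X) (T U : PTree X Ω) :
    joinₗ x (Finsupp.single T (1 : k)) (Finsupp.single U 1) = Finsupp.single (T.join x U) 1 := by
  simp [joinₗ]

theorem mapDomain_join_left (x : X) (T : PTree X Ω) (u : PTree X Ω →₀ k) :
    u.mapDomain (T.join x) = joinₗ x (Finsupp.single T 1) u := by
  change Finsupp.lmapDomain k k (T.join x) u = _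
  congr 1
  ext U : 2
  simp

theorem mapDomain_join_right (x : X) (W : PTree X Ω) (u : PTree X Ω →₀ k) :
    u.mapDomain (fun T => T.join x W) = joinₗ x u (Finsupp.single W 1) := by
  change Finsupp.lmapDomain k k (fun T => T.join x W) u = (joinₗ x).flip (Finsupp.single W 1) u
  congr 1
  ext U : 2
  simp

@[simp]
theorem Bplus_single (ω : Ω) (T : PTree X Ω) (r : k) :
    Bplus k ω (Finsupp.single T r) = Finsupp.single (T.graft ω) r := by
  simp [Bplus]

theorem single_cons (b : Branch Ω (PTree X Ω)) (x : X) (T : PTree X Ω) :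
    Finsupp.single (PTree.cons b x T) (1 : k) =
      joinₗ x (Finsupp.single (.last b) 1) (Finsupp.single T 1) := by
  rw [joinₗ_single]; rfl

theorem single_last_edge (ω : Ω) (T : PTree X Ω) :
    Finsupp.single (PTree.last (.edge ω T)) (1 : k) = Bplus k ω (Finsupp.single T 1) := by
  rw [Bplus_single]; rfl

theorem single_last_leaf : Finsupp.single (PTree.last (.leaf : Branch Ω (PTree X Ω))) (1 : k) =
    unitTree k := rfl

variable [Semigroup Ω] (lam : k)

/-- The product of two edges, as a combination of edges. -/
def branchMul : Branch Ω (PTree X Ω) → Branch Ω (PTree X Ω) → (Branch Ω (PTree X Ω) →₀ k)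
  | .leaf, c => Finsupp.single c 1
  | .edge α S, .leaf => Finsupp.single (.edge α S) 1
  | .edge α S, .edge β V =>
      (diamondTree lam (PTree.graft α S) V + diamondTree lam S (PTree.graft β V)
        + lam • diamondTree lam S V).mapDomain (.edge (α * β))

/-- This isolates the junction: all recursion happens in the product of two edges, and the rest of
`T` and `U` is a spectator. -/
theorem diamondTree_eq_mapDomain (T U : PTree X Ω) :
    diamondTree lam T U =
      (branchMul lam T.lastBranch U.firstBranch).mapDomain fun d => T.glue d U := by
  rw [diamondTree]
  split <;> simp only [branchMul, Finsupp.mapDomain_single, *]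
  rw [← Finsupp.mapDomain_comp]
  rfl

@[simp]
theorem diamond_single (T U : PTree X Ω) :
    diamond k lam (Finsupp.single T 1) (Finsupp.single U 1) = diamondTree lam T U := by
  simp [diamond]

theorem diamond_joinₗ_left (x : X) (a b c : PTree X Ω →₀ k) :
    diamond k lam (joinₗ x a b) c = joinₗ x a (diamond k lam b c) := by
  induction a using induction_basis with
  | zero => simp
  | add => simp [*]
  | smul => simp [*]
  | single T =>
  induction b using induction_basis with
  | zero => simp
  | add => simp [*]
  | smul => simp [*]
  | single U =>
  induction c using induction_basis with
  | zero => simp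
  | add _ _ h h' => simp only [map_add, h, h']
  | smul _ _ h => simp only [map_smul, h]
  | single W =>
  rw [joinₗ_single, diamond_single, diamond_single, ← mapDomain_join_left,
    diamondTree_eq_mapDomain, diamondTree_eq_mapDomain, ← Finsupp.mapDomain_comp]
  simp [PTree.join_glue, Function.comp_def]

theorem diamond_joinₗ_right (x : X) (a b c : PTree X Ω →₀ k) :
    diamond k lam a (joinₗ x b c) = joinₗ x (diamond k lam a b) c := by
  induction a using induction_basis with
  | zero => simp
  | add => simp [*]
  | smul => simp [*]
  | single T =>
  induction b using induction_basis with
  | zero => simp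
  | add => simp [*]
  | smul => simp [*]
  | single U =>
  induction c using induction_basis with
  | zero => simp
  | add _ _ h h' => simp only [map_add, h, h']
  | smul _ _ h => simp only [map_smul, h]
  | single W =>
  rw [joinₗ_single, diamond_single, diamond_single, ← mapDomain_join_right,
    diamondTree_eq_mapDomain, diamondTree_eq_mapDomain, ← Finsupp.mapDomain_comp]
  simp [PTree.glue_join, Function.comp_def]

theorem unitTree_diamond (a : PTree X Ω →₀ k) : diamond k lam (unitTree k) a = a := by
  induction a using induction_basis with
  | zero => simp
  | add => simp [*]
  | smul => simp [*]
  | single T =>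
  simp [unitTree, diamondTree_eq_mapDomain, PTree.lastBranch, branchMul, PTree.glue,
    PTree.setFirst_firstBranch]

theorem diamond_unitTree (a : PTree X Ω →₀ k) : diamond k lam a (unitTree k) = a := by
  induction a using induction_basis with
  | zero => simp
  | add => simp [*]
  | smul => simp [*]
  | single T =>
  have h : branchMul lam T.lastBranch .leaf = Finsupp.single T.lastBranch 1 := by
    cases T.lastBranch <;> rfl
  simp [unitTree, diamondTree_eq_mapDomain, PTree.firstBranch, h, PTree.glue_lastBranch]

/-- For roots with a single edge, gluing leaves only the product edge, so the recursive clause for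
two internal edges is the identity itself. -/
theorem Bplus_diamond_Bplus (α β : Ω) (a b : PTree X Ω →₀ k) :
    diamond k lam (Bplus k α a) (Bplus k β b) =
      Bplus k (α * β) (diamond k lam (Bplus k α a) b + diamond k lam a (Bplus k β b) +
        lam • diamond k lam a b) := by
  induction a using induction_basis with
  | zero => simp
  | add a a' h h' => simp only [map_add, LinearMap.add_apply, h, h', smul_add]; abel
  | smul r a h => simp [h, smul_comm lam r]
  | single S =>
  induction b using induction_basis with
  | zero => simp
  | add b b' h h' => simp only [map_add, h, h', smul_add]; abel
  | smul r b h => simp only [map_smul, h, smul_comm lam r, ← smul_add]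
  | single V =>
  simp only [Bplus_single, diamond_single]
  rw [diamondTree_eq_mapDomain]
  simp only [PTree.graft, PTree.lastBranch, PTree.firstBranch, branchMul,
    ← Finsupp.mapDomain_comp]
  rfl

/-- The inductive step of associativity. The seven hypotheses are associativity for the triples in
which a nonempty subset of the three grafts is removed; two applications of the Rota–Baxter identity
on each side produce exactly these triples. -/
theorem diamond_assoc_Bplus (α β γ : Ω) (s v w : PTree X Ω →₀ k)
    (h₁ : diamond k lam (diamond k lam (Bplus k α s) (Bplus k β v)) w =
      diamond k lam (Bplus k α s) (diamond k lam (Bplus k β v) w))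
    (h₂ : diamond k lam (diamond k lam (Bplus k α s) v) (Bplus k γ w) =
      diamond k lam (Bplus k α s) (diamond k lam v (Bplus k γ w)))
    (h₃ : diamond k lam (diamond k lam s (Bplus k β v)) (Bplus k γ w) =
      diamond k lam s (diamond k lam (Bplus k β v) (Bplus k γ w)))
    (h₄ : diamond k lam (diamond k lam s v) (Bplus k γ w) =
      diamond k lam s (diamond k lam v (Bplus k γ w)))
    (h₅ : diamond k lam (diamond k lam (Bplus k α s) v) w =
      diamond k lam (Bplus k α s) (diamond k lam v w))
    (h₆ : diamond k lam (diamond k lam s (Bplus k β v)) w =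
      diamond k lam s (diamond k lam (Bplus k β v) w))
    (h₇ : diamond k lam (diamond k lam s v) w = diamond k lam s (diamond k lam v w)) :
    diamond k lam (diamond k lam (Bplus k α s) (Bplus k β v)) (Bplus k γ w) =
      diamond k lam (Bplus k α s) (diamond k lam (Bplus k β v) (Bplus k γ w)) := by
  have hl := Bplus_diamond_Bplus lam (α * β) γ (diamond k lam (Bplus k α s) v +
    diamond k lam s (Bplus k β v) + lam • diamond k lam s v) w
  have hr := Bplus_diamond_Bplus lam α (β * γ) s (diamond k lam (Bplus k β v) w +
    diamond k lam v (Bplus k γ w) + lam • diamond k lam v w)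
  -- Only the inner operator applied to the three-term sum is folded back into a product of two
  -- grafts. This turns the left sides into the two bracketings and makes `h₁` and `h₃` applicable
  -- on the right.
  rw [← Bplus_diamond_Bplus] at hl hr
  rw [hl, hr, mul_assoc]
  congr 1
  simp only [map_add, map_smul, LinearMap.add_apply, LinearMap.smul_apply, smul_add,
    h₁, h₂, h₃, h₄, h₅, h₆, h₇]
  abel

theorem diamond_assoc_single (T U W : PTree X Ω) :
    diamond k lam (diamond k lam (Finsupp.single T 1) (Finsupp.single U 1)) (Finsupp.single W 1) =
      diamond k lam (Finsupp.single T 1)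
        (diamond k lam (Finsupp.single U 1) (Finsupp.single W 1)) := by
  match T, U, W with
  | .cons b x T, U, W =>
    simp only [single_cons, diamond_joinₗ_left, diamond_assoc_single T U W]
  -- The outer factors meet different sides of the angle `x`, so no induction hypothesis is needed.
  | T, .cons b x U, W =>
    simp only [single_cons, diamond_joinₗ_left, diamond_joinₗ_right]
  | T, U, .cons b x W =>
    simp only [single_cons, diamond_joinₗ_right, diamond_assoc_single T U (.last b)]
  | .last .leaf, U, W => simp only [single_last_leaf, unitTree_diamond]
  | T, .last .leaf, W => simp only [single_last_leaf, unitTree_diamond, diamond_unitTree]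
  | T, U, .last .leaf => simp only [single_last_leaf, diamond_unitTree]
  | .last (.edge α S), .last (.edge β V), .last (.edge γ W) =>
    have h₁ := diamond_assoc_single (.last (.edge α S)) (.last (.edge β V)) W
    have h₂ := diamond_assoc_single (.last (.edge α S)) V (.last (.edge γ W))
    have h₃ := diamond_assoc_single S (.last (.edge β V)) (.last (.edge γ W))
    have h₄ := diamond_assoc_single S V (.last (.edge γ W))
    have h₅ := diamond_assoc_single (.last (.edge α S)) V W
    have h₆ := diamond_assoc_single S (.last (.edge β V)) W
    have h₇ := diamond_assoc_single S V W
    simp only [single_last_edge] at *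
    exact diamond_assoc_Bplus lam α β γ _ _ _ h₁ h₂ h₃ h₄ h₅ h₆ h₇
termination_by sizeOf T + sizeOf U + sizeOf W
decreasing_by all_goals (simp; try omega)

theorem diamond_assoc (a b c : PTree X Ω →₀ k) :
    diamond k lam (diamond k lam a b) c = diamond k lam a (diamond k lam b c) := by
  induction a using induction_basis with
  | zero => simp
  | add => simp [*]
  | smul => simp [*]
  | single T =>
  induction b using induction_basis with
  | zero => simp
  | add => simp [*]
  | smul => simp [*]
  | single U =>
  induction c using induction_basis with
  | zero => simp
  | add _ _ h h' => simp only [map_add, h, h']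
  | smul _ _ h => simp only [map_smul, h]
  | single W => exact diamond_assoc_single lam T U W

theorem isRotaBaxterFamilyAlgebra_diamond :
    IsRotaBaxterFamilyAlgebra lam (diamond k (X := X) (Ω := Ω) lam) (unitTree k) (Bplus k) where
  assoc := diamond_assoc lam
  one_mul := unitTree_diamond lam
  mul_one := diamond_unitTree lam
  rota_baxter := Bplus_diamond_Bplus lam

end Diamond

-- Evaluation of trees and the universal property for Rota–Baxter family algebras.

section FreeRotaBaxter

variable {k : Type*} [CommRing k] {X Ω : Type*} {A : Type*} [AddCommGroup A] [Module k A]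
  (mul : A →ₗ[k] A →ₗ[k] A) (one : A) (P : Ω → A →ₗ[k] A) (f : X → A)

/-- The value of a tree in an algebra with operators, for given values of the angle decorations. -/
def PTree.eval : PTree X Ω → A
  | .last .leaf => one
  | .last (.edge ω T) => P ω T.eval
  -- The factor `one` is kept so that `PTree.eval_cons` holds uniformly in the edge, without any
  -- axiom on `A`.
  | .cons .leaf x T => mul (mul one (f x)) T.eval
  | .cons (.edge ω S) x T => mul (mul (P ω S.eval) (f x)) T.eval

/-- The linear extension of `PTree.eval`. -/
def evalₗ : (PTree X Ω →₀ k) →ₗ[k] A :=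
  Finsupp.linearCombination k (PTree.eval mul one P f)

theorem PTree.eval_cons (b : Branch Ω (PTree X Ω)) (x : X) (T : PTree X Ω) :
    (PTree.cons b x T).eval mul one P f =
      mul (mul ((PTree.last b).eval mul one P f) (f x)) (T.eval mul one P f) := by
  cases b <;> simp [PTree.eval]

@[simp]
theorem evalₗ_single (T : PTree X Ω) :
    evalₗ mul one P f (Finsupp.single T 1) = T.eval mul one P f := by
  simp [evalₗ]

theorem evalₗ_unitTree : evalₗ mul one P f (unitTree k) = one := by
  simp [unitTree, PTree.eval]

theorem evalₗ_Bplus (ω : Ω) (a : PTree X Ω →₀ k) :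
    evalₗ mul one P f (Bplus k ω a) = P ω (evalₗ mul one P f a) := by
  induction a using induction_basis with
  | zero => simp
  | add => simp [*]
  | smul => simp [*]
  | single T => simp [PTree.graft, PTree.eval]

variable [Semigroup Ω] {lam : k} {mul one P}

theorem evalₗ_genTree (h : IsRotaBaxterFamilyAlgebra lam mul one P) (x : X) :
    evalₗ mul one P f (genTree k x) = f x := by
  simp [genTree, PTree.eval, h.one_mul, h.mul_one]

theorem PTree.eval_join (h : IsRotaBaxterFamilyAlgebra lam mul one P) (x : X)
    (T U : PTree X Ω) :
    (T.join x U).eval mul one P f =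
      mul (mul (T.eval mul one P f) (f x)) (U.eval mul one P f) := by
  induction T using PTree.induction_on with
  | leaf => rw [join, eval_cons]
  | graft => rw [graft, join, eval_cons]
  | cons b y T _ ih => simp only [join, eval_cons, ih, h.assoc]

theorem evalₗ_joinₗ (h : IsRotaBaxterFamilyAlgebra lam mul one P) (x : X)
    (a b : PTree X Ω →₀ k) :
    evalₗ mul one P f (joinₗ x a b) =
      mul (mul (evalₗ mul one P f a) (f x)) (evalₗ mul one P f b) := by
  induction a using induction_basis with
  | zero => simp
  | add => simp [*]
  | smul => simp [*]
  | single T =>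
  induction b using induction_basis with
  | zero => simp
  | add => simp [*]
  | smul => simp [*]
  | single U => simp [PTree.eval_join f h]

/-- Same case division as for associativity: angles are pulled out, units drop, and two grafts are
compared through the Rota–Baxter identity on both sides. -/
theorem evalₗ_diamond_single (h : IsRotaBaxterFamilyAlgebra lam mul one P) (T U : PTree X Ω) :
    evalₗ mul one P f (diamond k lam (Finsupp.single T 1) (Finsupp.single U 1)) =
      mul (evalₗ mul one P f (Finsupp.single T 1)) (evalₗ mul one P f (Finsupp.single U 1)) := by
  match T, U with
  | .cons b x T, U =>
    simp only [single_cons, diamond_joinₗ_left, evalₗ_joinₗ f h, evalₗ_diamond_single h T U,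
      h.assoc]
  | T, .cons b x U =>
    simp only [single_cons, diamond_joinₗ_right, evalₗ_joinₗ f h,
      evalₗ_diamond_single h T (.last b), h.assoc]
  | .last .leaf, U => simp only [single_last_leaf, unitTree_diamond, evalₗ_unitTree, h.one_mul]
  | T, .last .leaf => simp only [single_last_leaf, diamond_unitTree, evalₗ_unitTree, h.mul_one]
  | .last (.edge α S), .last (.edge β V) =>
    have h₁ := evalₗ_diamond_single h (.last (.edge α S)) V
    have h₂ := evalₗ_diamond_single h S (.last (.edge β V))
    have h₃ := evalₗ_diamond_single h S V
    simp only [single_last_edge] at *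
    rw [Bplus_diamond_Bplus]
    simp only [evalₗ_Bplus] at *
    rw [h.rota_baxter]
    simp only [map_add, map_smul, h₁, h₂, h₃]
termination_by sizeOf T + sizeOf U
decreasing_by all_goals (simp; try omega)

theorem evalₗ_diamond (h : IsRotaBaxterFamilyAlgebra lam mul one P) (a b : PTree X Ω →₀ k) :
    evalₗ mul one P f (diamond k lam a b) =
      mul (evalₗ mul one P f a) (evalₗ mul one P f b) := by
  induction a using induction_basis with
  | zero => simp
  | add => simp [*]
  | smul => simp [*]
  | single T =>
  induction b using induction_basis with
  | zero => simp
  | add => simp [*]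
  | smul => simp [*]
  | single U => exact evalₗ_diamond_single f h T U

/-- This shows that the generators, the unit and the operators generate everything, whence
uniqueness of morphisms. -/
theorem single_cons_eq_diamond (lam : k) (b : Branch Ω (PTree X Ω)) (x : X) (T : PTree X Ω) :
    Finsupp.single (PTree.cons b x T) (1 : k) =
      diamond k lam (diamond k lam (Finsupp.single (.last b) 1) (genTree k x))
        (Finsupp.single T 1) := by
  rw [genTree, single_cons .leaf, single_last_leaf, diamond_joinₗ_right, diamond_joinₗ_left,
    diamond_unitTree, unitTree_diamond, single_cons]

theorem eq_evalₗ (F : (PTree X Ω →₀ k) →ₗ[k] A) (h_one : F (unitTree k) = one)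
    (h_mul : ∀ a b, F (diamond k lam a b) = mul (F a) (F b))
    (h_P : ∀ ω a, F (Bplus k ω a) = P ω (F a)) (h_gen : ∀ x, F (genTree k x) = f x) :
    F = evalₗ mul one P f := by
  ext T
  simp only [LinearMap.coe_comp, Function.comp_apply, Finsupp.lsingle_apply, evalₗ_single]
  induction T using PTree.induction_on with
  | leaf => rw [single_last_leaf, h_one, PTree.eval]
  | graft ω T ih => rw [PTree.graft, single_last_edge, h_P, ih, PTree.eval]
  | cons b x T hb ih =>
    rw [single_cons_eq_diamond lam, h_mul, h_mul, hb, ih, h_gen, PTree.eval_cons]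

theorem isFreeRotaBaxterFamilyAlgebra_diamond (lam : k) :
    IsFreeRotaBaxterFamilyAlgebra.{w} lam (diamond k (X := X) (Ω := Ω) lam) (unitTree k)
      (Bplus k) (genTree k) := by
  refine ⟨isRotaBaxterFamilyAlgebra_diamond lam, ?_⟩
  intro A _ _ mul one P h f
  refine ⟨evalₗ mul one P f, ⟨evalₗ_unitTree _ _ _ _, evalₗ_diamond f h, evalₗ_Bplus _ _ _ _,
    evalₗ_genTree f h⟩, ?_⟩
  rintro F ⟨h₁, h₂, h₃, h₄⟩
  exact eq_evalₗ f F h₁ h₂ h₃ h₄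

end FreeRotaBaxter

-- The inclusion of binary trees and its image.

section Inclusion

variable {k : Type*} [CommRing k] {X Ω : Type*}

@[simp]
theorem incl_single (T : BTree X Ω) :
    incl k (Finsupp.single T 1) = Finsupp.single T.toPTree 1 := by
  simp [incl]

theorem incl_injective : Function.Injective (incl k (X := X) (Ω := Ω)) :=
  Finsupp.mapDomain_injective BTree.toPTree_injective

theorem range_incl : LinearMap.range (incl k (X := X) (Ω := Ω)) = binarySpan k X Ω := by
  apply le_antisymm
  · rintro _ ⟨a, rfl⟩
    induction a using induction_basis with
    | zero => simp
    | add a b ha hb => rw [map_add]; exact add_mem ha hb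
    | smul r a ha => rw [map_smul]; exact Submodule.smul_mem _ r ha
    | single T => exact Submodule.subset_span ⟨_, T.isBinary_toPTree, (incl_single T).symm⟩
  · refine Submodule.span_le.2 ?_
    rintro _ ⟨T, hT, rfl⟩
    obtain ⟨S, rfl⟩ := PTree.IsBinary.exists_toPTree hT
    exact ⟨_, incl_single S⟩

theorem incl_genBTree (x : X) : incl k (Ω := Ω) (genBTree k x) = genTree k x := by
  simp [genBTree, genTree, BTree.toPTree, branchToPTree]

end Inclusion

-- Dendriform structures, induced and recursive.

section Dendriform

variable {k : Type*} [CommRing k] {X Ω : Type*} [Semigroup Ω]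

/-- The middle axiom is associativity; the outer two are associativity together with the Rota–Baxter
identity, whose third term vanishes in weight 0. -/
theorem IsRotaBaxterFamilyAlgebra.isDendriformFamilyAlgebra {R : Type*} [AddCommGroup R]
    [Module k R] {mul : R →ₗ[k] R →ₗ[k] R} {one : R} {P : Ω → R →ₗ[k] R}
    (h : IsRotaBaxterFamilyAlgebra (0 : k) mul one P) :
    IsDendriformFamilyAlgebra (inducedPrec k mul P) (inducedSucc k mul P) where
  prec_prec α β x y z := by
    simp [inducedPrec, inducedSucc, h.assoc, h.rota_baxter, add_comm]
  succ_prec α β x y z := by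
    simp [inducedPrec, inducedSucc, h.assoc]
  succ_succ α β x y z := by
    have := h.rota_baxter α β x y
    simp [inducedPrec, inducedSucc, ← h.assoc, this, add_comm]

theorem IsDendriformFamilyAlgebra.of_injective {D E : Type*} [AddCommGroup D] [Module k D]
    [AddCommGroup E] [Module k E] {p s : Ω → D →ₗ[k] D →ₗ[k] D} {p' s' : Ω → E →ₗ[k] E →ₗ[k] E}
    (h : IsDendriformFamilyAlgebra p' s') {F : D →ₗ[k] E} (hF : Function.Injective F)
    (hom : IsDendriformFamilyHom p s p' s' F) : IsDendriformFamilyAlgebra p s where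
  prec_prec α β x y z := hF (by simp only [hom.map_prec, hom.map_succ, map_add, h.prec_prec])
  succ_prec α β x y z := hF (by simp only [hom.map_prec, hom.map_succ, h.succ_prec])
  succ_succ α β x y z := hF (by
    rw [hom.map_succ, map_add, hom.map_prec, hom.map_succ, h.succ_succ, hom.map_succ,
      hom.map_succ])

@[simp]
theorem prec_single (ω : Ω) (T U : BTree X Ω) :
    prec k ω (Finsupp.single T 1) (Finsupp.single U 1) = precTree k ω T U := by
  simp [prec]

@[simp]
theorem succ_single (ω : Ω) (T U : BTree X Ω) :
    succ k ω (Finsupp.single T 1) (Finsupp.single U 1) = succTree k ω T U := by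
  simp [succ]

/-- A linear map on the span of the binary trees respects the operations as soon as it does so on
the four kinds of products of trees by which these are defined. -/
theorem isDendriformFamilyHom_of_node {E : Type*} [AddCommGroup E] [Module k E]
    {p s : Ω → E →ₗ[k] E →ₗ[k] E} {F : (BTree X Ω →₀ k) →ₗ[k] E}
    (prec_leaf : ∀ ω l x U, F (Finsupp.single (.node l x (.edge ω U)) 1) =
      p ω (F (Finsupp.single (.node l x .leaf) 1)) (F (Finsupp.single U 1)))
    (prec_edge : ∀ ω l x α R U,
      p (α * ω) (F (Finsupp.single (.node l x .leaf) 1))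
        (p ω (F (Finsupp.single R 1)) (F (Finsupp.single U 1)) +
          s α (F (Finsupp.single R 1)) (F (Finsupp.single U 1))) =
      p ω (F (Finsupp.single (.node l x (.edge α R)) 1)) (F (Finsupp.single U 1)))
    (succ_leaf : ∀ ω T y r, F (Finsupp.single (.node (.edge ω T) y r) 1) =
      s ω (F (Finsupp.single T 1)) (F (Finsupp.single (.node .leaf y r) 1)))
    (succ_edge : ∀ ω T β L y r,
      s (ω * β) (p β (F (Finsupp.single T 1)) (F (Finsupp.single L 1)) +
          s ω (F (Finsupp.single T 1)) (F (Finsupp.single L 1)))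
        (F (Finsupp.single (.node .leaf y r) 1)) =
      s ω (F (Finsupp.single T 1)) (F (Finsupp.single (.node (.edge β L) y r) 1))) :
    IsDendriformFamilyHom (prec k) (succ k) p s F := by
  -- The recursion puts linear combinations of trees on an edge, so `prec_leaf` is needed linearly
  -- in the carried tree.
  have map_right : ∀ ω l x (u : BTree X Ω →₀ k),
      F (u.mapDomain fun W => .node l x (.edge ω W)) =
        p ω (F (Finsupp.single (.node l x .leaf) 1)) (F u) := by
    intro ω l x u
    change (F ∘ₗ Finsupp.lmapDomain k k fun W => .node l x (.edge ω W)) u =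
      (p ω (F (Finsupp.single (.node l x .leaf) 1)) ∘ₗ F) u
    congr 1
    ext U
    simp [prec_leaf]
  have map_left : ∀ ω y r (u : BTree X Ω →₀ k),
      F (u.mapDomain fun W => .node (.edge ω W) y r) =
        s ω (F u) (F (Finsupp.single (.node .leaf y r) 1)) := by
    intro ω y r u
    change (F ∘ₗ Finsupp.lmapDomain k k fun W => .node (.edge ω W) y r) u =
      ((s ω).flip (F (Finsupp.single (.node .leaf y r) 1)) ∘ₗ F) u
    congr 1
    ext U
    simp [succ_leaf]
  -- The two operations call each other, and with changed types, so both are treated together and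
  -- for all `ω`.
  have key : ∀ (n : ℕ) (T U : BTree X Ω), sizeOf T + sizeOf U ≤ n → ∀ ω,
      F (precTree k ω T U) = p ω (F (Finsupp.single T 1)) (F (Finsupp.single U 1)) ∧
      F (succTree k ω T U) = s ω (F (Finsupp.single T 1)) (F (Finsupp.single U 1)) := by
    intro n
    induction n with
    | zero => rintro ⟨l, x, r⟩ U h; simp at h
    | succ n ih =>
      intro T U h ω
      constructor
      · obtain ⟨l, x, _ | ⟨α, R⟩⟩ := T
        · rw [precTree, prec_leaf]
        · have hR := ih R U (by simp at h; omega)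
          rw [precTree, map_right, map_add, (hR _).1, (hR _).2, prec_edge]
      · obtain ⟨_ | ⟨β, L⟩, y, r⟩ := U
        · rw [succTree, succ_leaf]
        · have hL := ih T L (by simp at h; omega)
          rw [succTree, map_left, map_add, (hL _).1, (hL _).2, succ_edge]
  constructor
  · intro ω a b
    have : (prec k ω).compr₂ F = (p ω).compl₁₂ F F :=
      bilinear_ext fun T U => by simpa using (key _ T U le_rfl ω).1
    exact LinearMap.congr_fun₂ this a b
  · intro ω a b
    have : (succ k ω).compr₂ F = (s ω).compl₁₂ F F :=
      bilinear_ext fun T U => by simpa using (key _ T U le_rfl ω).2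
    exact LinearMap.congr_fun₂ this a b

/-- The inclusion of the binary trees carries the recursive operations to the induced ones. -/
theorem isDendriformFamilyHom_incl :
    IsDendriformFamilyHom (prec k) (succ k)
      (inducedPrec k (diamond k (X := X) (Ω := Ω) 0) (Bplus k))
      (inducedSucc k (diamond k (X := X) (Ω := Ω) 0) (Bplus k)) (incl k) := by
  have h := (isRotaBaxterFamilyAlgebra_diamond (X := X) (Ω := Ω)
    (0 : k)).isDendriformFamilyAlgebra
  -- The rightmost edge of the left factor is a leaf, so the product merely puts the grafted edge in
  -- its place.
  have hp : ∀ ω l x (U : BTree X Ω), incl k (Finsupp.single (.node l x (.edge ω U)) 1) =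
      inducedPrec k (diamond k 0) (Bplus k) ω
        (incl k (Finsupp.single (.node l x .leaf) 1)) (incl k (Finsupp.single U 1)) := by
    intro ω l x U
    simp only [incl_single, BTree.toPTree, branchToPTree, single_cons, single_last_edge,
      single_last_leaf, inducedPrec, LinearMap.compl₂_apply, diamond_joinₗ_left, unitTree_diamond]
  have hs : ∀ ω T y (r : Branch Ω (BTree X Ω)),
      incl k (Finsupp.single (.node (.edge ω T) y r) 1) =
        inducedSucc k (diamond k 0) (Bplus k) ω
          (incl k (Finsupp.single T 1)) (incl k (Finsupp.single (.node .leaf y r) 1)) := by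
    intro ω T y r
    simp only [incl_single, BTree.toPTree, branchToPTree, single_cons, single_last_edge,
      single_last_leaf, inducedSucc, LinearMap.comp_apply, diamond_joinₗ_right, diamond_unitTree]
  refine isDendriformFamilyHom_of_node hp ?_ hs ?_
  · intro ω l x α R U
    rw [hp, h.prec_prec]
  · intro ω T β L y r
    rw [hs, h.succ_succ]

/-- The axioms are pulled back along the injective inclusion, which avoids an induction over triples
of binary trees. -/
theorem isDendriformFamilyAlgebra_prec_succ :
    IsDendriformFamilyAlgebra (prec k (X := X) (Ω := Ω)) (succ k) :=
  (isRotaBaxterFamilyAlgebra_diamond (X := X) (Ω := Ω)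
    (0 : k)).isDendriformFamilyAlgebra.of_injective incl_injective isDendriformFamilyHom_incl

theorem isDendriformFamilySubalgebra_binarySpan :
    IsDendriformFamilySubalgebra
      (inducedPrec k (diamond k (X := X) (Ω := Ω) 0) (Bplus k))
      (inducedSucc k (diamond k (X := X) (Ω := Ω) 0) (Bplus k)) (binarySpan k X Ω) where
  isDendriform := (isRotaBaxterFamilyAlgebra_diamond (0 : k)).isDendriformFamilyAlgebra
  prec_mem ω := by
    rw [← range_incl]
    rintro _ ⟨a, rfl⟩ _ ⟨b, rfl⟩
    exact ⟨prec k ω a b, isDendriformFamilyHom_incl.map_prec ω a b⟩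
  succ_mem ω := by
    rw [← range_incl]
    rintro _ ⟨a, rfl⟩ _ ⟨b, rfl⟩
    exact ⟨succ k ω a b, isDendriformFamilyHom_incl.map_succ ω a b⟩

end Dendriform

-- Evaluation of binary trees and the universal property for dendriform family algebras.

section FreeDendriform

variable {k : Type*} [CommRing k] {X Ω : Type*} {E : Type*} [AddCommGroup E] [Module k E]
  (p s : Ω → E →ₗ[k] E →ₗ[k] E) (f : X → E)

/-- The value of a binary tree in a module with two families of bilinear operations, for given
values of the angle decorations. -/
def BTree.eval : BTree X Ω → E
  | .node .leaf x .leaf => f x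
  | .node (.edge α L) x .leaf => s α L.eval (f x)
  | .node .leaf x (.edge β R) => p β (f x) R.eval
  | .node (.edge α L) x (.edge β R) => p β (s α L.eval (f x)) R.eval

/-- The linear extension of `BTree.eval`. -/
def evalBₗ : (BTree X Ω →₀ k) →ₗ[k] E :=
  Finsupp.linearCombination k (BTree.eval p s f)

@[simp]
theorem evalBₗ_single (T : BTree X Ω) :
    evalBₗ p s f (Finsupp.single T 1) = T.eval p s f := by
  simp [evalBₗ]

theorem evalBₗ_genBTree (x : X) : evalBₗ p s f (genBTree k x) = f x := by
  simp [genBTree, BTree.eval]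

theorem BTree.eval_node_edge_right (l : Branch Ω (BTree X Ω)) (x : X) (β : Ω)
    (R : BTree X Ω) : (BTree.node l x (.edge β R)).eval p s f =
      p β ((BTree.node l x .leaf).eval p s f) (R.eval p s f) := by
  cases l <;> simp [BTree.eval]

variable [Semigroup Ω] {p s}

/-- Evaluation brackets a node as `(L ≻ x) ≺ R`; the axiom `succ_prec` allows the bracketing `L ≻ (x
≺ R)`. -/
theorem BTree.eval_node_edge_left (h : IsDendriformFamilyAlgebra p s) (α : Ω) (L : BTree X Ω)
    (x : X) (r : Branch Ω (BTree X Ω)) : (BTree.node (.edge α L) x r).eval p s f =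
      s α (L.eval p s f) ((BTree.node .leaf x r).eval p s f) := by
  cases r <;> simp [BTree.eval, h.succ_prec]

theorem isDendriformFamilyHom_evalBₗ (h : IsDendriformFamilyAlgebra p s) :
    IsDendriformFamilyHom (prec k) (succ k) p s (evalBₗ (X := X) p s f) := by
  apply isDendriformFamilyHom_of_node <;> intros <;> simp only [evalBₗ_single]
  · rw [BTree.eval_node_edge_right]
  · rw [BTree.eval_node_edge_right, h.prec_prec]
  · rw [BTree.eval_node_edge_left f h]
  · rw [BTree.eval_node_edge_left f h, h.succ_succ]

/-- Each tree decomposes as `(L ≻ x) ≺ R`, with absent sides omitted, so the values on generators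
determine `F`. -/
theorem eq_evalBₗ {F : (BTree X Ω →₀ k) →ₗ[k] E}
    (hF : IsDendriformFamilyHom (prec k) (succ k) p s F) (h_gen : ∀ x, F (genBTree k x) = f x) :
    F = evalBₗ p s f := by
  have hr : ∀ l x β (R : BTree X Ω), F (Finsupp.single (.node l x (.edge β R)) 1) =
      p β (F (Finsupp.single (.node l x .leaf) 1)) (F (Finsupp.single R 1)) := by
    intro l x β R
    rw [← hF.map_prec, prec_single, precTree]
  have hl : ∀ α (L : BTree X Ω) x, F (Finsupp.single (.node (.edge α L) x .leaf) 1) =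
      s α (F (Finsupp.single L 1)) (f x) := by
    intro α L x
    rw [← h_gen, genBTree, ← hF.map_succ, succ_single, succTree]
  ext T
  simp only [LinearMap.coe_comp, Function.comp_apply, Finsupp.lsingle_apply, evalBₗ_single]
  induction T using BTree.induction_on with
  | node l x r ihl ihr =>
    have h₁ : F (Finsupp.single (.node l x .leaf) 1) = (BTree.node l x .leaf).eval p s f := by
      obtain _ | ⟨α, L⟩ := l
      · exact h_gen x
      · rw [hl, ihl _ _ rfl, BTree.eval]
    obtain _ | ⟨β, R⟩ := r
    · exact h₁
    · rw [hr, h₁, ihr _ _ rfl, BTree.eval_node_edge_right]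

theorem isFreeDendriformFamilyAlgebra_prec_succ :
    IsFreeDendriformFamilyAlgebra.{w} (prec k (X := X) (Ω := Ω)) (succ k) (genBTree k) := by
  refine ⟨isDendriformFamilyAlgebra_prec_succ, ?_⟩
  intro E _ _ p s h f
  exact ⟨evalBₗ p s f, ⟨isDendriformFamilyHom_evalBₗ f h, evalBₗ_genBTree p s f⟩,
    fun F hF => eq_evalBₗ f hF.1 hF.2⟩

end FreeDendriform

end

end FamilyTrees

theorem theorem3p4 (k : Type*) [CommRing k] (X Ω : Type*) [Semigroup Ω] :
    -- `(k𝒯, ⋄, B⁺)` is the free Rota–Baxter family algebra of weight `0` on `X`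
    FamilyTrees.IsFreeRotaBaxterFamilyAlgebra.{w} (0 : k)
      (FamilyTrees.diamond k (X := X) (Ω := Ω) 0) (FamilyTrees.unitTree k)
      (FamilyTrees.Bplus k) (FamilyTrees.genTree k) ∧
    -- the span of the binary trees, with `≺_ω` and `≻_ω` defined recursively, is the free
    -- dendriform family algebra on `X`
    FamilyTrees.IsFreeDendriformFamilyAlgebra.{w} (FamilyTrees.prec k (X := X) (Ω := Ω))
      (FamilyTrees.succ k) (FamilyTrees.genBTree k) ∧
    -- the natural inclusion identifies it with the submodule of `k𝒯` spanned by the binary trees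
    Function.Injective (FamilyTrees.incl k (X := X) (Ω := Ω)) ∧
    LinearMap.range (FamilyTrees.incl k (X := X) (Ω := Ω)) = FamilyTrees.binarySpan k X Ω ∧
    (∀ x : X, FamilyTrees.incl k (Ω := Ω) (FamilyTrees.genBTree k x) =
      FamilyTrees.genTree k x) ∧
    -- this submodule is a dendriform family subalgebra of `k𝒯` with the induced operations
    FamilyTrees.IsDendriformFamilySubalgebra
      (FamilyTrees.inducedPrec k (FamilyTrees.diamond k (X := X) (Ω := Ω) 0)
        (FamilyTrees.Bplus k))
      (FamilyTrees.inducedSucc k (FamilyTrees.diamond k (X := X) (Ω := Ω) 0)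
        (FamilyTrees.Bplus k))
      (FamilyTrees.binarySpan k X Ω) ∧
    -- and the inclusion carries the recursive operations to the induced ones
    (∀ (ω : Ω) (a b : FamilyTrees.BTree X Ω →₀ k),
      FamilyTrees.incl k (FamilyTrees.prec k ω a b) =
        FamilyTrees.diamond k 0 (FamilyTrees.incl k a)
          (FamilyTrees.Bplus k ω (FamilyTrees.incl k b)) ∧
      FamilyTrees.incl k (FamilyTrees.succ k ω a b) =
        FamilyTrees.diamond k 0 (FamilyTrees.Bplus k ω (FamilyTrees.incl k a))
          (FamilyTrees.incl k b)) := by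
  exact ⟨FamilyTrees.isFreeRotaBaxterFamilyAlgebra_diamond 0,
    FamilyTrees.isFreeDendriformFamilyAlgebra_prec_succ, FamilyTrees.incl_injective,
    FamilyTrees.range_incl, FamilyTrees.incl_genBTree,
    FamilyTrees.isDendriformFamilySubalgebra_binarySpan,
    fun ω a b => ⟨FamilyTrees.isDendriformFamilyHom_incl.map_prec ω a b,
      FamilyTrees.isDendriformFamilyHom_incl.map_succ ω a b⟩⟩
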